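/- Let $a<b$ be positive integers. For an integer $c$ put $M_{1,c}=\begin{pmatrix}0&1\\1&c\end{pmatrix}$ and let $$M_1=M_{1,a}^2,\qquad M_2=\big(M_{1,a}M_{1,b}M_{1,a}^{-1}\big)^2 .$$ *Wug-snake graphs.* Let $w=(w_{i,j})_{1\le i,j\le n}$ be a matrix of non-negative integers with $w_{j+1,j}=1$ for all $j$ and $w_{i,j}=0$ for $i>j+1$. The wug-snake graph $K_n(w)$ is the bipartite multigraph with vertices $u_1,\dots,u_n,v_1,\dots,v_n$ and $w_{i,j}$ parallel edges between $u_i$ and $v_j$. For $k\le n$ let $K_k(w)$ be its subgraph on the vertices with indices at most $k$, and let $\mu(K_k(w))$ be the number of perfect matchings of $K_k(w)$; the perfect matching sequence of $K_n(w)$ is $(\mu(K_k(w)))_{k=1}^n$. Adding the row $(\alpha,\beta,\gamma)$ to a wug-snake graph of size $n-1$ means adding vertices $u_n,v_n$ with $w_{n-2,n}=\alpha$, $w_{n-1,n}=\beta$, $w_{n,n}=\gamma$, $w_{n,n-1}=1$, all other new weights being $0$. The element of $M_1$ consists of the rows $(0,1,a),(0,1,a)$, and the element of $M_2$ of the rows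 $(0,b-a,1),(1,0,a),(0,b-a,1),(1,0,a)$, added in this order. A head for $(0,0,1)$ is a wug-snake graph of size at least $3$ whose perfect matching sequence ends with $0,0,1$. *Markov numbers.* For an integer $2\times2$ matrix $M$ let $f_M(v)=\det(v,Mv)$ be its Markov--Davenport form. The algebraic Markov number of $M$ is $|f_M(0,1)|$, the absolute value of its upper right entry, and its geometric Markov number is $\inf_{p\in\mathbb Z^2\setminus\{0\}}|f_M(p)|$. *Farey set.* Let $\mathcal F$ be the map from $\mathbb Q\cap[0,1]$ to the semigroup generated by $M_1$ and $M_2$ with $\mathcal F(0)=M_1$, $\mathcal F(1)=M_2$ and $\mathcal F\big(\tfrac{p+p'}{q+q'}\big)=\mathcal F\big(\tfrac pq\big)\mathcal F\big(\tfrac{p'}{q'}\big)$ for all fractions $\tfrac pq<\tfrac{p'}{q'}$ in $[0,1]$ in lowest terms with $p'q-pq'=1$. Then: 1. In a common basis of $\mathbb Z^2$ the matrices $M_1$ and $M_2$ are reduced with PLLS-sequences $(a,a)$ and $(b,b)$; that is, for some $U\in \mathrm{GL}(2,\mathbb Z)$ we have $U^{-1}M_1U=M_{1,a}M_{1,a}$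 and $U^{-1}M_2U=M_{1,b}M_{1,b}$. 2. For $i=1,2$ and every wug-snake graph of size at least $2$ whose perfect matching sequence ends with $x,y$, the perfect matching sequence of the graph obtained by adding the element of $M_i$ ends with $u,v$, where $\binom uv=M_i\binom xy$. 3. There is a head of size $3$ for $(0,0,1)$. For every $t\in\mathbb Q\cap[0,1]$ the matrix $\mathcal F(t)$ is a product of the generators; and for every way of writing $\mathcal F(t)=M_{i_1}M_{i_2}\cdots M_{i_k}$ and every head for $(0,0,1)$, add to the head successively the elements of $M_{i_k},\dots,M_{i_2},M_{i_1}$, and omit the last pair of vertices. The number of perfect matchings of the resulting wug-snake graph is equal to the upper right entry of $\mathcal F(t)$, to the algebraic Markov number of $\mathcal F(t)$, and to the geometric Markov number of $\mathcal F(t)$. -/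

import Mathlib

open Matrix

/-! ### Wug-snake graphs and their perfect matchings -/

/-- A finite wug-snake graph `K_n(w)` on the vertices `u_1, …, u_n`, `v_1, …, v_n`.
Indices are shifted by one: `weight i j` is the weight (the multiplicity) of the edge joining
`u_{i+1}` and `v_{j+1}`; only the values at `i, j < size` matter. The weight matrix vanishes below
the subdiagonal and is equal to `1` on the subdiagonal. -/
structure WugSnake where
  size : ℕ
  weight : ℕ → ℕ → ℕ
  weight_below : ∀ i j, i < size → j + 1 < i → weight i j = 0
  weight_sub : ∀ j, j + 1 < size → weight (j + 1) j = 1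

namespace WugSnake

/-- The edges of the bipartite multigraph `K_k(w)` on `u_1, …, u_k`, `v_1, …, v_k`:
`w i j` parallel edges between `u_{i+1}` and `v_{j+1}`. -/
abbrev Edge (w : ℕ → ℕ → ℕ) (k : ℕ) : Type :=
  Σ p : Fin k × Fin k, Fin (w p.1 p.2)

/-- A set of edges is a perfect matching if every vertex is incident to exactly one of them. -/
def IsPerfectMatching (w : ℕ → ℕ → ℕ) (k : ℕ) (S : Set (Edge w k)) : Prop :=
  (∀ i : Fin k, ∃! e : Edge w k, e ∈ S ∧ e.1.1 = i) ∧
  (∀ j : Fin k, ∃! e : Edge w k, e ∈ S ∧ e.1.2 = j)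

/-- The number `μ(K_k(w))` of perfect matchings of the `k`-th graph of the filtration of `W`
(meaningful for `k ≤ W.size`); for `k = 1, …, W.size` this is the perfect matching sequence. -/
noncomputable def mu (W : WugSnake) (k : ℕ) : ℕ :=
  Set.ncard {S : Set (Edge W.weight k) | IsPerfectMatching W.weight k S}

/-- `W` is a head for the starting sequence `x`: its perfect matching sequence ends with `x`. -/
def IsHead (W : WugSnake) (x : List ℕ) : Prop :=
  x.length ≤ W.size ∧
    ∀ (k : ℕ) (hk : k < x.length), W.mu (W.size - x.length + k + 1) = x[k]

/-- Add one pair of vertices `u_n, v_n` to a wug-snake graph of size `n - 1`, following the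
recurrence `x_n = α x_{n-3} + β x_{n-2} + γ x_{n-1}`: the edges `u_{n-2} v_n`, `u_{n-1} v_n`,
`u_n v_n` get the weights `α`, `β`, `γ`, and `u_n v_{n-1}` gets the weight `1`.
The triple `(α, β, γ)` is the last row of the transposed Frobenius companion matrix with rows
`(0, 1, 0)`, `(0, 0, 1)`, `(α, β, γ)`. -/
def snoc (W : WugSnake) (c : ℕ × ℕ × ℕ) : WugSnake where
  size := W.size + 1
  weight i j :=
    if i < W.size ∧ j < W.size then W.weight i j
    else if i = j + 1 then 1
    else if i = j then c.2.2
    else if i + 1 = j then c.2.1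
    else if i + 2 = j then c.1
    else 0
  weight_below i j hi hj := by
    split_ifs with h
    · exact W.weight_below i j h.1 hj
    all_goals first | rfl | omega
  weight_sub j hj := by
    by_cases h : j + 1 < W.size ∧ j < W.size
    · rw [if_pos h]
      exact W.weight_sub j h.1
    · rw [if_neg h, if_pos rfl]

/-- Attach a body to a wug-snake graph, the body being given by the successive rows of
recurrence coefficients. -/
def attach (W : WugSnake) (body : List (ℕ × ℕ × ℕ)) : WugSnake :=
  body.foldl snoc W

end WugSnake

/-! ### Markov–Davenport forms and Markov numbers of `2 × 2` matrices -/

/-- The Markov–Davenport form `f_M(v) = det(v, M v)`, with `v` and `M v` as columns. -/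
def markovDavenport (M : Matrix (Fin 2) (Fin 2) ℤ) (v : Fin 2 → ℤ) : ℤ :=
  Matrix.det (Matrix.of ![v, M *ᵥ v])ᵀ

/-- The algebraic Markov number: the value of the Markov–Davenport form at `(0, 1)`, up to the
sign that comes from the order of the two columns in the determinant. -/
def algebraicMarkov (M : Matrix (Fin 2) (Fin 2) ℤ) : ℤ :=
  |markovDavenport M ![0, 1]|

/-- The geometric Markov number: the infimum of `|f_M|` over the non-zero integer vectors. -/
noncomputable def geometricMarkov (M : Matrix (Fin 2) (Fin 2) ℤ) : ℝ :=
  ⨅ p : {p : Fin 2 → ℤ // p ≠ 0}, |(markovDavenport M p.1 : ℝ)|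

/-! ### Farey maps -/

/-- The mediant (Farey sum) of two rational numbers. -/
def mediant (r s : ℚ) : ℚ :=
  ((r.num + s.num : ℤ) : ℚ) / ((r.den + s.den : ℕ) : ℚ)

/-- `r < s` form an edge of the Farey graph on the rational numbers of `[0, 1]`. -/
def FareyEdge (r s : ℚ) : Prop :=
  0 ≤ r ∧ s ≤ 1 ∧ s.num * r.den - r.num * s.den = 1

/-- `F` is a Farey map for the pair `(A, B)`; its values outside `[0, 1]` are irrelevant. -/
structure IsFareyMap {G : Type*} [Monoid G] (A B : G) (F : ℚ → G) : Prop where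
  zero : F 0 = A
  one : F 1 = B
  map_mediant : ∀ r s : ℚ, FareyEdge r s → F (mediant r s) = F r * F s

theorem ediv_mediant_left {p q p' q' i : ℤ} (hq : 0 < q) (hq' : 0 < q')
    (h : p' * q - p * q' = 1) (hi : 0 ≤ i) (hiq : i ≤ q) :
    (p + p') * i / (q + q') = p * i / q := by
  have e := Int.mul_ediv_add_emod (p * i) q
  have r0 := Int.emod_nonneg (p * i) hq.ne'
  have r1 := Int.emod_lt_of_pos (p * i) hq
  set k := p * i / q
  set c := p * i % q
  have hs : 0 < q + q' := by positivity
  have key : q * ((p + p') * i) = (q + q') * (q * k + c) + i := by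
    rw [e]; linear_combination i * h
  apply le_antisymm
  · rw [← Int.lt_add_one_iff, Int.ediv_lt_iff_lt_mul hs]
    by_contra hc
    push Not at hc
    nlinarith
  · rw [Int.le_ediv_iff_mul_le hs]
    by_contra hc
    push Not at hc
    nlinarith

theorem ediv_mediant_right {p q p' q' j : ℤ} (hq : 0 < q) (hq' : 0 < q')
    (h : p' * q - p * q' = 1) (hj : 0 ≤ j) (hjq : j ≤ q') :
    (p + p') * (q + j) / (q + q') = p + p' * j / q' := by
  have e := Int.mul_ediv_add_emod (p' * j) q'
  have r0 := Int.emod_nonneg (p' * j) hq'.ne'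
  have r1 := Int.emod_lt_of_pos (p' * j) hq'
  set k := p' * j / q'
  set c := p' * j % q'
  have hs : 0 < q + q' := by positivity
  have key : q' * ((p + p') * (q + j)) = (q + q') * (q' * (p + k) + c) + (q' - j) := by
    linear_combination (q' - j) * h - (q + q') * e
  apply le_antisymm
  · rw [← Int.lt_add_one_iff, Int.ediv_lt_iff_lt_mul hs]
    by_contra hc
    push Not at hc
    nlinarith
  · rw [Int.le_ediv_iff_mul_le hs]
    by_contra hc
    push Not at hc
    nlinarith

theorem mediant_num_den {r s : ℚ} (h : s.num * r.den - r.num * s.den = 1) :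
    (mediant r s).num = r.num + s.num ∧ (mediant r s).den = r.den + s.den := by
  have hc : Int.gcd (r.num + s.num) ((r.den + s.den : ℕ) : ℤ) = 1 := by
    rw [← Int.isCoprime_iff_gcd_eq_one]
    refine ⟨r.den, -r.num, ?_⟩
    push_cast
    linear_combination h
  have hpos : (0 : ℤ) < ((r.den + s.den : ℕ) : ℤ) := by
    have := r.den_pos
    omega
  have hm : mediant r s
      = ((r.num + s.num : ℤ) : ℚ) / (((r.den + s.den : ℕ) : ℤ) : ℚ) := by
    simp [mediant]
  rw [hm]
  refine ⟨Rat.num_div_eq_of_coprime hpos hc, ?_⟩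
  exact_mod_cast Rat.den_div_eq_of_coprime hpos hc

/-- Farey maps exist. -/
theorem exists_isFareyMap {G : Type*} [Monoid G] (A B : G) : ∃ F : ℚ → G, IsFareyMap A B F := by
  classical
  refine ⟨fun t => ((List.range t.den).map fun i : ℕ =>
    if t.num * ((i : ℤ) + 1) / t.den = t.num * (i : ℤ) / t.den then A else B).prod, ?_, ?_, ?_⟩
  · simp
  · simp
  · intro r s hrs
    obtain ⟨-, -, h⟩ := hrs
    obtain ⟨hn, hd⟩ := mediant_num_den h
    have hq : (0 : ℤ) < r.den := by exact_mod_cast r.den_pos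
    have hq' : (0 : ℤ) < s.den := by exact_mod_cast s.den_pos
    simp only [hn, hd, List.range_add, List.map_append, List.prod_append, List.map_map]
    congr 2
    · apply List.map_congr_left
      intro i hi
      have hi' : (i : ℤ) < r.den := by exact_mod_cast List.mem_range.mp hi
      push_cast
      rw [ediv_mediant_left hq hq' h (by positivity) (by linarith),
        ediv_mediant_left hq hq' h (by positivity) (by linarith)]
    · apply List.map_congr_left
      intro j hj
      have hj' : (j : ℤ) < s.den := by exact_mod_cast List.mem_range.mp hj
      simp only [Function.comp]
      push_cast
      rw [add_assoc (r.den : ℤ), ediv_mediant_right hq hq' h (by positivity) (by linarith),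
        ediv_mediant_right hq hq' h (by positivity) (by linarith)]
      simp

/-- The Farey map of the pair `(A, B)`. On the rational numbers of `[0, 1]` it is determined by
`0 ↦ A`, `1 ↦ B` and the rule for mediants. -/
noncomputable def fareyMap {G : Type*} [Monoid G] (A B : G) : ℚ → G :=
  Classical.choose (exists_isFareyMap A B)

/-! ### The semigroup and its wug-snake graphs -/

/-- The transposed Frobenius companion matrix `M_{1,c}`. -/
def compMat (c : ℤ) : Matrix (Fin 2) (Fin 2) ℤ := !![0, 1; 1, c]

/-- The generators `M_1 = M_{1,a}^2` and `M_2 = (M_{1,a} M_{1,b} M_{1,a}⁻¹)^2`. -/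
noncomputable def gen (a b : ℕ) : Fin 2 → Matrix (Fin 2) (Fin 2) ℤ :=
  ![compMat a ^ 2, (compMat a * compMat b * (compMat a)⁻¹) ^ 2]

/-- In the basis given by `U`, the matrix `M` is reduced and its PLLS-sequence is `l`
(the sequence of the factors `M_{1,c}` in reversed order). -/
def HasPLLS (U : GL (Fin 2) ℤ) (M : Matrix (Fin 2) (Fin 2) ℤ) (l : List ℕ) : Prop :=
  (∀ c ∈ l, 0 < c) ∧
    (U⁻¹ : GL (Fin 2) ℤ).val * M * U.val = (l.reverse.map fun c : ℕ => compMat c).prod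

/-- The building elements of the wug-snake graphs that correspond to `M_1` and `M_2`, in the order
in which the vertices are added. For `a < b` all weights are natural numbers. -/
def block (a b : ℕ) : Fin 2 → List (ℕ × ℕ × ℕ) :=
  ![[(0, 1, a), (0, 1, a)],
    [(0, b - a, 1), (1, 0, a), (0, b - a, 1), (1, 0, a)]]

/-- The body of the wug-snake graph for the product `M_{w_1} M_{w_2} ⋯ M_{w_k}`: matrices act from
the left, so the elements are added in the order `w_k, …, w_2, w_1`. -/
def body (a b : ℕ) (w : List (Fin 2)) : List (ℕ × ℕ × ℕ) :=
  w.reverse.flatMap (block a b)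

/-! Matchings of a bipartite multigraph are counted by a permanent. The weight matrix is Hessenberg
with unit subdiagonal, so expansion along the last column gives the linear recurrence `mu_succ`.
Hence each element acts on the last two terms of the sequence as its matrix, a body acts as the
product, and starting from (0, 1) the second to last term is the upper right entry of the product.

For the Markov numbers, conjugation by M_{1,a} turns the generators into the symmetric matrices
M_{1,a}^2 and M_{1,b}^2, and F(t) into their product over the mechanical word of slope t and
intercept zero; the upper right entry becomes the lower left one. Cutting the first quadrant into
cones along images of the basis vectors shows that |f| on non-zero integer vectors is at least any
common lower bound for the off-diagonal entries of all rotations of the word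
(`le_abs_markovDavenport`).

For slope p/q the rotations are mechanical words with intercepts among 0, ..., q - 1. Raising the
intercept by one replaces a factor 01 by 10, and the words on its two sides, read outward, are
comparable prefixes (`mechWord_succ`). Such an exchange cannot decrease the lower left entry
(`wordMat_exchange_le`), so intercept zero is minimal. The bound is attained at (0, 1). -/

namespace WugSnake

/-! ### Permanents and the matching recurrence. -/

/-- The number of perfect matchings is the permanent of the weight matrix. -/
theorem ncard_isPerfectMatching (w : ℕ → ℕ → ℕ) (k : ℕ) :
    Set.ncard {S : Set (Edge w k) | IsPerfectMatching w k S}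
      = ∑ σ : Equiv.Perm (Fin k), ∏ i : Fin k, w i (σ i) := by
  -- A perfect matching is a permutation together with a choice, for each row, of one of the
  -- parallel edges.
  let Φ : (Σ σ : Equiv.Perm (Fin k), ∀ i : Fin k, Fin (w i (σ i))) →
      {S : Set (Edge w k) | IsPerfectMatching w k S} := fun x =>
    ⟨Set.range fun i : Fin k => (⟨(i, x.1 i), x.2 i⟩ : Edge w k), by
      constructor
      · intro i
        refine ⟨⟨(i, x.1 i), x.2 i⟩, ⟨⟨i, rfl⟩, rfl⟩, ?_⟩
        rintro _ ⟨⟨i', rfl⟩, h⟩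
        obtain rfl : i' = i := h
        rfl
      · intro j
        refine ⟨⟨(x.1.symm j, x.1 (x.1.symm j)), x.2 _⟩, ⟨⟨_, rfl⟩, by simp⟩, ?_⟩
        rintro _ ⟨⟨i', rfl⟩, h⟩
        obtain rfl : x.1 i' = j := h
        simp only
        rw [Equiv.symm_apply_apply]⟩
  have hΦ : Function.Bijective Φ := by
    constructor
    · rintro ⟨σ, c⟩ ⟨σ', c'⟩ h
      have h1 := congrArg Subtype.val h
      simp only [Φ] at h1
      have h2 : ∀ i, (⟨(i, σ i), c i⟩ : Edge w k) = ⟨(i, σ' i), c' i⟩ := by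
        intro i
        have : (⟨(i, σ i), c i⟩ : Edge w k) ∈
            Set.range fun i : Fin k => (⟨(i, σ' i), c' i⟩ : Edge w k) := by
          rw [← h1]; exact ⟨i, rfl⟩
        obtain ⟨i', hi'⟩ := this
        have : i' = i := congrArg (fun e : Edge w k => e.1.1) hi'
        subst this
        exact hi'.symm
      have hσ : σ = σ' := Equiv.ext fun i => congrArg (fun e : Edge w k => e.1.2) (h2 i)
      subst hσ
      congr 1
      funext i
      exact eq_of_heq (Sigma.mk.inj (h2 i)).2
    · rintro ⟨S, hr, hc⟩
      have hr' := hr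
      choose e he heu using hr'
      simp only at heu
      have hb : Function.Bijective fun i => (e i).1.2 := by
        refine Finite.injective_iff_bijective.mp ?_
        intro i i' h
        obtain ⟨e', -, hu⟩ := hc (e i).1.2
        have h1 := hu (e i) ⟨(he i).1, rfl⟩
        have h2 := hu (e i') ⟨(he i').1, h.symm⟩
        rw [← (he i).2, ← (he i').2, h1, h2]
      have hex : ∀ i : Fin k, ∃ c : Fin (w i ((e i).1.2)), (⟨(i, (e i).1.2), c⟩ : Edge w k) = e i := by
        intro i
        have hi := (he i).2
        rcases h : e i with ⟨⟨x, y⟩, c⟩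
        rw [h] at hi
        obtain rfl : x = i := hi
        exact ⟨c, rfl⟩
      choose c hc' using hex
      refine ⟨⟨Equiv.ofBijective _ hb, c⟩, Subtype.ext ?_⟩
      ext x
      constructor
      · rintro ⟨i, rfl⟩
        have := (he i).1
        rw [← hc' i] at this
        exact this
      · intro hx
        refine ⟨x.1.1, ?_⟩
        exact (hc' x.1.1).trans (heu x.1.1 x ⟨hx, rfl⟩).symm
  rw [← Nat.card_coe_set_eq, ← Nat.card_congr (Equiv.ofBijective Φ hΦ), Nat.card_eq_fintype_card]
  simp [Fintype.card_sigma, Fintype.card_pi]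

/-- Each permutation of `Option α` is uniquely a swap of `none` with its image `i`, composed with a
permutation fixing `none`. -/
theorem sum_perm_option {α : Type*} [Fintype α] [DecidableEq α] (A : Option α → Option α → ℕ) :
    ∑ σ : Equiv.Perm (Option α), ∏ x, A x (σ x)
      = ∑ i, A none i * ∑ τ : Equiv.Perm α, ∏ x : α,
          A (some x) (Equiv.swap none i (some (τ x))) := by
  rw [← Equiv.sum_comp Equiv.Perm.decomposeOption.symm, Fintype.sum_prod_type]
  refine Finset.sum_congr rfl fun i _ => ?_
  rw [Finset.mul_sum]
  refine Finset.sum_congr rfl fun τ _ => ?_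
  rw [Fintype.prod_option]
  simp [Equiv.Perm.decomposeOption]

/-- Expansion of a permanent along its last row. The `j`-th minor is taken after moving the last
column to the place of the `j`-th one. -/
theorem sum_perm_fin_succ (n : ℕ) (A : Fin (n + 1) → Fin (n + 1) → ℕ) :
    ∑ σ : Equiv.Perm (Fin (n + 1)), ∏ x, A x (σ x)
      = A (Fin.last n) (Fin.last n) * ∑ τ : Equiv.Perm (Fin n), ∏ x, A x.castSucc (τ x).castSucc
        + ∑ j : Fin n, A (Fin.last n) j.castSucc * ∑ τ : Equiv.Perm (Fin n), ∏ x,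
          A x.castSucc (if τ x = j then Fin.last n else (τ x).castSucc) := by
  have h := sum_perm_option (α := Fin n)
    (fun x y => A (finSuccEquivLast.symm x) (finSuccEquivLast.symm y))
  have h2 : ∀ σ : Equiv.Perm (Option (Fin n)),
      ∏ x, A x (((finSuccEquivLast (n := n)).symm.permCongr σ) x)
        = ∏ x, A (finSuccEquivLast.symm x) (finSuccEquivLast.symm (σ x)) := by
    intro σ
    rw [← Equiv.prod_comp (finSuccEquivLast (n := n)).symm]
    simp [Equiv.permCongr_apply]
  rw [← Equiv.sum_comp (finSuccEquivLast (n := n)).symm.permCongr]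
  simp_rw [h2]
  rw [h, Fintype.sum_option]
  simp only [Equiv.swap_self, Equiv.refl_apply, finSuccEquivLast_symm_none,
    finSuccEquivLast_symm_some]
  congr 1
  refine Finset.sum_congr rfl fun j _ => ?_
  congr 1
  refine Finset.sum_congr rfl fun τ _ => Finset.prod_congr rfl fun x _ => ?_
  by_cases hx : τ x = j
  · simp [hx]
  · rw [if_neg hx, Equiv.swap_apply_of_ne_of_ne (by simp) (by simpa using hx)]
    simp

/-- Expansion along the last column `c` of the permanent of a matrix that vanishes below the
subdiagonal and is equal to `1` on the subdiagonal. -/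
theorem sum_perm_hessenberg (w : ℕ → ℕ → ℕ) (c : ℕ → ℕ) (k : ℕ)
    (hb : ∀ i j, i ≤ k → j + 1 < i → w i j = 0) (hs : ∀ j, j < k → w (j + 1) j = 1) :
    ∑ σ : Equiv.Perm (Fin (k + 1)), ∏ x, (if σ x = Fin.last k then c x else w x (σ x))
      = ∑ i ∈ Finset.range (k + 1), c i * ∑ σ : Equiv.Perm (Fin i), ∏ x : Fin i, w x (σ x) := by
  induction k with
  | zero =>
    simp [Fin.eq_zero]
  | succ k ih =>
    have ih := ih (fun i j hi hj => hb i j (by omega) hj) (fun j hj => hs j (by omega))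
    rw [Finset.sum_range_succ, ← ih, sum_perm_fin_succ (k + 1)
      (fun x y => if y = Fin.last (k + 1) then c x else w x y), add_comm]
    congr 1
    -- Only the subdiagonal entry of the last row survives. Its minor has column `k` replaced by the
    -- last column, which is again a Hessenberg matrix with last column `c`; this is why `c` is kept
    -- arbitrary.
    · rw [Fin.sum_univ_castSucc, Finset.sum_eq_zero, zero_add]
      · simp only [Fin.castSucc_ne_last, if_false, Fin.val_last, Fin.val_castSucc]
        rw [hs k (by omega), one_mul]
        refine Finset.sum_congr rfl fun τ _ => Finset.prod_congr rfl fun x _ => ?_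
        by_cases h : τ x = Fin.last k
        · simp [h]
        · simp [h]
      · intro j _
        simp only [Fin.castSucc_ne_last, if_false, Fin.val_last, Fin.val_castSucc]
        rw [hb (k + 1) j le_rfl (by omega), zero_mul]
    · simp

theorem mu_eq (W : WugSnake) (k : ℕ) :
    W.mu k = ∑ σ : Equiv.Perm (Fin k), ∏ i : Fin k, W.weight i (σ i) :=
  ncard_isPerfectMatching _ _

theorem mu_zero (W : WugSnake) : W.mu 0 = 1 := by
  simp [mu_eq]

/-- An edge from row `i` to the last column forces the rows below `i` onto the subdiagonal, where
the weights are 1, and leaves a perfect matching of the `i`-th graph. -/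
theorem mu_succ (W : WugSnake) (k : ℕ) (hk : k < W.size) :
    W.mu (k + 1) = ∑ i ∈ Finset.range (k + 1), W.weight i k * W.mu i := by
  simp only [mu_eq]
  rw [← sum_perm_hessenberg W.weight (fun i => W.weight i k) k
    (fun i j hi hj => W.weight_below i j (by omega) hj)
    (fun j hj => W.weight_sub j (by omega))]
  refine Finset.sum_congr rfl fun τ _ => Finset.prod_congr rfl fun x _ => ?_
  split_ifs with h
  · rw [h, Fin.val_last]
  · rfl

theorem snoc_size (W : WugSnake) (c : ℕ × ℕ × ℕ) : (W.snoc c).size = W.size + 1 := rfl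

theorem snoc_mu_of_le (W : WugSnake) (c : ℕ × ℕ × ℕ) (k : ℕ) (hk : k ≤ W.size) :
    (W.snoc c).mu k = W.mu k := by
  simp only [mu_eq]
  refine Finset.sum_congr rfl fun τ _ => Finset.prod_congr rfl fun x _ => ?_
  have h1 := x.2
  have h2 := (τ x).2
  simp only [snoc]
  rw [if_pos ⟨by omega, by omega⟩]

theorem snoc_mu_succ (W : WugSnake) (α β γ n : ℕ) (hn : W.size = n + 2) :
    (W.snoc (α, β, γ)).mu (n + 3) = α * W.mu n + β * W.mu (n + 1) + γ * W.mu (n + 2) := by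
  rw [mu_succ _ (n + 2) (by rw [snoc_size]; omega), Finset.sum_range_succ, Finset.sum_range_succ,
    Finset.sum_range_succ, Finset.sum_eq_zero, snoc_mu_of_le _ _ n (by omega),
    snoc_mu_of_le _ _ (n + 1) (by omega), snoc_mu_of_le _ _ (n + 2) (by omega)]
  · simp [snoc, hn, show n ≠ n + 2 + 1 by omega]
  · intro i hi
    have := Finset.mem_range.mp hi
    have : (W.snoc (α, β, γ)).weight i (n + 2) = 0 := by
      simp only [snoc, hn]
      split_ifs <;> omega
    rw [this, zero_mul]

/-! ### Action of the building elements on the last two terms. -/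

/-- The last two terms of the perfect matching sequence. -/
noncomputable def lastTwo (W : WugSnake) : Fin 2 → ℤ :=
  ![(W.mu (W.size - 1) : ℤ), (W.mu W.size : ℤ)]

/-- With first coefficient 0 the first row sees only the last two terms x, y; after it the sequence
ends x, y, z, and the second row reaches back exactly to x. So a pair of rows acts linearly on (x,
y). -/
theorem snoc_snoc_lastTwo (W : WugSnake) (α β γ β' γ' : ℕ) (hW : 2 ≤ W.size) :
    ((W.snoc (0, β', γ')).snoc (α, β, γ)).lastTwo
      = ![β' * W.lastTwo 0 + γ' * W.lastTwo 1,
          α * W.lastTwo 0 + β * W.lastTwo 1 + γ * (β' * W.lastTwo 0 + γ' * W.lastTwo 1)] := by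
  obtain ⟨n, hn⟩ := Nat.exists_eq_add_of_le' hW
  have hs : (W.snoc (0, β', γ')).size = n + 1 + 2 := by rw [snoc_size, hn]
  have h1 := snoc_mu_succ W 0 β' γ' n hn
  have h2 := snoc_mu_of_le W (0, β', γ') (n + 2) hn.ge
  have h2' := snoc_mu_of_le W (0, β', γ') (n + 1) (by omega)
  have h3 := snoc_mu_succ (W.snoc (0, β', γ')) α β γ (n + 1) hs
  have h4 := snoc_mu_of_le (W.snoc (0, β', γ')) (α, β, γ) (n + 3) hs.ge
  rw [h2, h2', h1] at h3
  rw [h1] at h4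
  simp [lastTwo, snoc_size, hn, h3, h4]

theorem attach_append (W : WugSnake) (l l' : List (ℕ × ℕ × ℕ)) :
    W.attach (l ++ l') = (W.attach l).attach l' := by
  simp [attach]

theorem attach_size (W : WugSnake) (l : List (ℕ × ℕ × ℕ)) :
    (W.attach l).size = W.size + l.length := by
  induction l generalizing W with
  | nil => rfl
  | cons c l ih =>
    have := ih (W.snoc c)
    rw [snoc_size] at this
    simp only [attach, List.foldl_cons, List.length_cons] at this ⊢
    omega

end WugSnake

theorem compMat_inv (c : ℤ) : (compMat c)⁻¹ = !![-c, 1; 1, 0] := by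
  apply Matrix.inv_eq_right_inv
  ext i j
  fin_cases i <;> fin_cases j <;> simp [compMat, Matrix.mul_apply, Fin.sum_univ_two]

theorem gen_zero (a b : ℕ) : gen a b 0 = !![1, (a : ℤ); a, 1 + a * a] := by
  simp [gen, compMat, pow_two]

/-- This square root of M_2 is what one pair of rows (0, b - a, 1), (1, 0, a) realises; the element
of M_2 repeats the pair twice. -/
theorem gen_one_sqrt (a b : ℕ) :
    compMat a * compMat b * (compMat a)⁻¹ = !![(b : ℤ) - a, 1; 1 + a * (b - a), a] := by
  rw [compMat_inv]
  ext i j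
  fin_cases i <;> fin_cases j <;>
    simp [compMat, Matrix.mul_apply, Fin.sum_univ_two] <;> ring

namespace WugSnake

theorem attach_block_lastTwo (a b : ℕ) (hab : a < b) (i : Fin 2) (W : WugSnake)
    (hW : 2 ≤ W.size) :
    (W.attach (block a b i)).lastTwo = gen a b i *ᵥ W.lastTwo := by
  fin_cases i
  · simp only [Fin.zero_eta, block, Matrix.cons_val_zero, attach, List.foldl_cons, List.foldl_nil,
      gen_zero]
    rw [snoc_snoc_lastTwo W 0 1 a 1 a hW]
    ext j
    fin_cases j <;> simp [Matrix.mulVec, dotProduct, Fin.sum_univ_two]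
    ring
  · change ((((W.snoc (0, b - a, 1)).snoc (1, 0, a)).snoc (0, b - a, 1)).snoc (1, 0, a)).lastTwo
      = ((compMat a * compMat b * (compMat a)⁻¹) ^ 2) *ᵥ W.lastTwo
    rw [gen_one_sqrt]
    rw [snoc_snoc_lastTwo _ 1 0 a (b - a) 1 (by simp only [snoc_size]; omega),
      snoc_snoc_lastTwo W 1 0 a (b - a) 1 hW]
    ext j
    fin_cases j <;>
      simp [pow_two, Matrix.mulVec, dotProduct, Fin.sum_univ_two, Nat.cast_sub hab.le] <;> ring

theorem attach_body_lastTwo (a b : ℕ) (hab : a < b) (w : List (Fin 2)) (W : WugSnake)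
    (hW : 2 ≤ W.size) :
    (W.attach (body a b w)).lastTwo = (w.map (gen a b)).prod *ᵥ W.lastTwo := by
  induction w with
  | nil => simp [body, attach]
  | cons i w ih =>
    have h : body a b (i :: w) = body a b w ++ block a b i := by simp [body]
    rw [h, attach_append, attach_block_lastTwo a b hab i _ (by rw [attach_size]; omega), ih,
      Matrix.mulVec_mulVec, List.map_cons, List.prod_cons]

theorem IsHead.lastTwo {W : WugSnake} (h : W.IsHead [0, 0, 1]) :
    2 ≤ W.size ∧ W.lastTwo = ![0, 1] := by
  obtain ⟨hl, hv⟩ := h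
  simp only [List.length_cons, List.length_nil] at hl hv
  have h1 := hv 1 (by omega)
  have h2 := hv 2 (by omega)
  rw [show W.size - (0 + 1 + 1 + 1) + 1 + 1 = W.size - 1 by omega] at h1
  rw [show W.size - (0 + 1 + 1 + 1) + 2 + 1 = W.size by omega] at h2
  refine ⟨by omega, ?_⟩
  simp [WugSnake.lastTwo, h1, h2]

theorem exists_isHead : ∃ H : WugSnake, H.size = 3 ∧ H.IsHead [0, 0, 1] := by
  let H : WugSnake :=
    { size := 3
      -- The permutation matrix of a 3-cycle: its only perfect matching uses all three edges, so no
      -- smaller graph of the filtration of positive size has one.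
      weight := fun i j => if i = j + 1 then 1 else if i = 0 ∧ j = 2 then 1 else 0
      weight_below := fun i j _ hj => by
        rw [if_neg (by omega), if_neg (by omega)]
      weight_sub := fun j _ => by simp }
  have h1 : H.mu 1 = 0 := by
    rw [mu_succ H 0 (by simp [H])]; simp [H]
  have h2 : H.mu 2 = 0 := by
    rw [mu_succ H 1 (by simp [H])]; simp [H]
  have h3 : H.mu 3 = 1 := by
    rw [mu_succ H 2 (by simp [H])]; simp [H, Finset.sum_range_succ, mu_zero]
  refine ⟨H, rfl, le_rfl, fun k hk => ?_⟩
  have : k = 0 ∨ k = 1 ∨ k = 2 := by simp at hk; omega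
  rcases this with rfl | rfl | rfl
  · exact h1
  · exact h2
  · exact h3

end WugSnake

/-! ### Products of symmetric letters over words. -/

/-- The symmetric matrix `M_{1,c}^2`. -/
def sqMat (c : ℕ) : Matrix (Fin 2) (Fin 2) ℤ := !![1, (c : ℤ); c, 1 + c * c]

/-- The product of the matrices `M_{1,c}^2` over a word of positive integers. -/
def wordMat (l : List ℕ) : Matrix (Fin 2) (Fin 2) ℤ := (l.map sqMat).prod

theorem wordMat_nil : wordMat [] = 1 := rfl

theorem wordMat_cons (c : ℕ) (l : List ℕ) : wordMat (c :: l) = sqMat c * wordMat l := by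
  simp [wordMat]

theorem wordMat_append (l l' : List ℕ) : wordMat (l ++ l') = wordMat l * wordMat l' := by
  simp [wordMat]

theorem wordMat_singleton (c : ℕ) : wordMat [c] = sqMat c := by
  simp [wordMat]

theorem sqMat_transpose (c : ℕ) : (sqMat c)ᵀ = sqMat c := by
  ext i j
  fin_cases i <;> fin_cases j <;> simp [sqMat]

/-- The letters are symmetric matrices. Reversal thus exchanges the two off-diagonal entries, which
lets bounds for one serve for the other. -/
theorem wordMat_reverse (l : List ℕ) : wordMat l.reverse = (wordMat l)ᵀ := by
  induction l with
  | nil => simp [wordMat_nil]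
  | cons c l ih =>
    rw [List.reverse_cons, wordMat_append, wordMat_singleton, ih, wordMat_cons,
      Matrix.transpose_mul, sqMat_transpose]

theorem wordMat_nonneg (l : List ℕ) (i j : Fin 2) : 0 ≤ wordMat l i j := by
  induction l generalizing i j with
  | nil => fin_cases i <;> fin_cases j <;> simp [wordMat_nil]
  | cons c l ih =>
    rw [wordMat_cons, Matrix.mul_apply, Fin.sum_univ_two]
    have h : ∀ i j, 0 ≤ sqMat c i j := by
      intro i j
      fin_cases i <;> fin_cases j <;> simp [sqMat]
      positivity
    exact add_nonneg (mul_nonneg (h _ _) (ih _ _)) (mul_nonneg (h _ _) (ih _ _))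

theorem wordMat_det (l : List ℕ) : (wordMat l).det = 1 := by
  induction l with
  | nil => simp [wordMat_nil]
  | cons c l ih =>
    rw [wordMat_cons, Matrix.det_mul, ih, Matrix.det_fin_two]
    simp [sqMat]

/-! ### Lower bounds for Markov–Davenport forms. -/

theorem markovDavenport_apply (M : Matrix (Fin 2) (Fin 2) ℤ) (x y : ℤ) :
    markovDavenport M ![x, y] = M 1 0 * x ^ 2 + (M 1 1 - M 0 0) * x * y - M 0 1 * y ^ 2 := by
  simp [markovDavenport, Matrix.det_fin_two]
  ring

/-- The Markov–Davenport form of a cyclically rotated product. -/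
theorem markovDavenport_mul_comm (A B : Matrix (Fin 2) (Fin 2) ℤ) (v : Fin 2 → ℤ) :
    markovDavenport (A * B) (A *ᵥ v) = A.det * markovDavenport (B * A) v := by
  have e : (Matrix.of ![A *ᵥ v, (A * B) *ᵥ (A *ᵥ v)])ᵀ
      = A * (Matrix.of ![v, (B * A) *ᵥ v])ᵀ := by
    ext i j
    fin_cases i <;> fin_cases j <;> simp [Matrix.mul_apply, Fin.sum_univ_two] <;> ring
  rw [markovDavenport, e, Matrix.det_mul, markovDavenport]

/-- For fixed s the form is concave in t because B ≥ 0. At the endpoints t = 0 and t = c s it is at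
least m s^2, hence also between them, and s^2 ≥ 1. -/
theorem le_of_concave {m A B C s t c : ℤ} (hc : 0 < c) (hB : 0 ≤ B) (hs : 1 ≤ s) (ht : 0 ≤ t)
    (htc : t ≤ c * s) (h0 : m ≤ A) (h1 : m ≤ A + C * c - B * c ^ 2) (hm : 0 ≤ m) :
    m ≤ A * s ^ 2 + C * s * t - B * t ^ 2 := by
  have key : c * (A * s ^ 2 + C * s * t - B * t ^ 2)
      = s * ((c * s - t) * A + t * (A + C * c - B * c ^ 2)) + B * c * t * (c * s - t) := by
    ring
  have h2 : m * (c * s) ≤ (c * s - t) * A + t * (A + C * c - B * c ^ 2) := by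
    nlinarith [mul_le_mul_of_nonneg_left h0 (sub_nonneg.mpr htc),
      mul_le_mul_of_nonneg_left h1 ht]
  have h3 : 0 ≤ B * c * t * (c * s - t) := by
    have := sub_nonneg.mpr htc
    positivity
  have h4 : m * c ≤ s * (m * (c * s)) := by
    have : m * c * 1 ≤ m * c * (s * s) := by gcongr; nlinarith
    linarith
  have h5 : s * (m * (c * s))
      ≤ s * ((c * s - t) * A + t * (A + C * c - B * c ^ 2)) := by gcongr
  have : c * m ≤ c * (A * s ^ 2 + C * s * t - B * t ^ 2) := by linarith
  exact le_of_mul_le_mul_left this hc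

/-- A lower bound for the off-diagonal entries of all rotations of a word bounds the
Markov–Davenport form on the first quadrant. -/
theorem le_abs_markovDavenport_of_nonneg {m : ℤ} (hm : 0 ≤ m) (n : ℕ) :
    ∀ (l : List ℕ), l ≠ [] → (∀ c ∈ l, 0 < c) →
      (∀ k, m ≤ wordMat (l.rotate k) 1 0 ∧ m ≤ wordMat (l.rotate k) 0 1) →
      ∀ x y : ℤ, 0 ≤ x → 0 ≤ y → 0 < x + y → x + y ≤ n →
        m ≤ |markovDavenport (wordMat l) ![x, y]| := by
  induction n with
  | zero => intro l _ _ _ x y _ _ h1 h2; push_cast at h2; omega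
  | succ n ih =>
    intro l hl hpos hrot x y hx hy hxy hn
    obtain ⟨c, l, rfl⟩ := List.exists_cons_of_ne_nil hl
    have hc : 1 ≤ (c : ℤ) := by exact_mod_cast hpos c (by simp)
    have e1 : (c :: l).rotate 1 = l ++ [c] := by simp
    have h0 := hrot 0
    have h1 := hrot 1
    rw [List.rotate_zero] at h0
    rw [e1] at h1
    set M := wordMat (c :: l) with hM
    -- Moving the first letter to the end is a base change by `sqMat c`, so the values at the images
    -- of the two basis vectors are, up to sign, off-diagonal entries of the rotated word.
    have f1 : markovDavenport M ![1, (c : ℤ)] = wordMat (l ++ [c]) 1 0 := by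
      have := markovDavenport_mul_comm (sqMat c) (wordMat l) ![1, 0]
      rw [← wordMat_cons, ← wordMat_singleton c, ← wordMat_append, wordMat_det,
        wordMat_singleton, markovDavenport_apply (wordMat (l ++ [c]))] at this
      have ev : sqMat c *ᵥ ![1, 0] = ![1, (c : ℤ)] := by
        ext j; fin_cases j <;> simp [sqMat, Matrix.mulVec, dotProduct, Fin.sum_univ_two]
      rw [ev] at this
      rw [this]; ring
    have f2 : markovDavenport M ![(c : ℤ), 1 + c * c] = - wordMat (l ++ [c]) 0 1 := by
      have := markovDavenport_mul_comm (sqMat c) (wordMat l) ![0, 1]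
      rw [← wordMat_cons, ← wordMat_singleton c, ← wordMat_append, wordMat_det,
        wordMat_singleton, markovDavenport_apply (wordMat (l ++ [c]))] at this
      have ev : sqMat c *ᵥ ![0, 1] = ![(c : ℤ), 1 + c * c] := by
        ext j; fin_cases j <;> simp [sqMat, Matrix.mulVec, dotProduct, Fin.sum_univ_two]
      rw [ev] at this
      rw [this]; ring
    rw [markovDavenport_apply] at f1 f2
    have hB := wordMat_nonneg (c :: l) 0 1
    rw [← hM] at hB
    -- The vectors (1, c) and (c, 1 + c^2) cut the quadrant into three cones. On the outer two
    -- concavity gives the bound. The middle one is the image of the quadrant under `sqMat c`, where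
    -- the rotated word takes over with a smaller coordinate sum.
    rcases le_total y (c * x) with hyc | hyc
    · have hx1 : 1 ≤ x := by
        by_contra h
        obtain rfl : x = 0 := by omega
        simp at hyc; omega
      rw [markovDavenport_apply]
      refine le_trans ?_ (le_abs_self _)
      refine le_of_concave (c := c) (by omega) hB hx1 hy hyc h0.1 ?_ hm
      linarith [h1.1]
    · rcases le_total ((c : ℤ) * y) ((1 + c * c) * x) with hyx | hyx
      · have ev : sqMat c *ᵥ ![(1 + c * c) * x - c * y, y - c * x] = ![x, y] := by
          ext j
          fin_cases j <;> simp [sqMat, Matrix.mulVec, dotProduct, Fin.sum_univ_two] <;> ring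
        have h := markovDavenport_mul_comm (sqMat c) (wordMat l)
          ![(1 + c * c) * x - c * y, y - c * x]
        rw [ev, ← wordMat_cons, ← wordMat_singleton c, ← wordMat_append, wordMat_det,
          one_mul] at h
        rw [hM, h]
        refine ih (l ++ [c]) (by simp) (fun d hd' => hpos d (by simpa [or_comm] using hd')) ?_ _ _
          (by linarith) (by linarith) ?_ ?_
        · intro k
          rw [← e1, List.rotate_rotate]
          exact hrot _
        · by_contra hneg
          have u1 : (1 + c * c) * x - c * y = 0 := by linarith
          have u2 : y - c * x = 0 := by linarith
          have : x = 0 := by linear_combination u1 + c * u2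
          have : y = 0 := by linear_combination u2 + c * this
          omega
        · push_cast at hn
          have u1 : 0 ≤ (1 + c * c) * x - c * y := by linarith
          have u2 : 0 ≤ y - c * x := by linarith
          have ex : x = ((1 + c * c) * x - c * y) + c * (y - c * x) := by ring
          have ey : y = c * ((1 + c * c) * x - c * y) + (1 + c * c) * (y - c * x) := by ring
          set X := (1 + c * c) * x - c * y
          set Y := y - c * x
          have : 1 ≤ x + y - X - Y := by
            by_contra hneg
            have : x + y - X - Y = c * X + c * Y + c * c * Y := by linear_combination ex + ey
            have h3 : 0 ≤ c * c * Y := by positivity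
            have : c * (X + Y) ≤ 0 := by linarith
            have h5 : X + Y ≤ c * (X + Y) := by nlinarith
            have : X = 0 := by linarith
            have : Y = 0 := by linarith
            rw [‹X = 0›, ‹Y = 0›] at ex ey
            simp at ex ey
            omega
          linarith
      · have hy1 : 1 ≤ y - c * x := by
          by_contra h
          have : y = c * x := by omega
          rw [this] at hyx
          have : x = 0 := by linarith
          subst this
          simp at this
          omega
        have hA : 0 ≤ M 1 0 + (M 1 1 - M 0 0) * c - M 0 1 * c ^ 2 := by
          have := wordMat_nonneg (l ++ [c]) 1 0
          linarith
        rw [markovDavenport_apply, ← abs_neg]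
        refine le_trans ?_ (le_abs_self _)
        -- Here (x, y) = s (0, 1) + t (1, c), and the form is -f in the coordinates s, t; the end t
        -- = c s is the direction (c, 1 + c^2).
        have := le_of_concave (m := m) (A := M 0 1)
          (B := M 1 0 + (M 1 1 - M 0 0) * c - M 0 1 * c ^ 2)
          (C := - (M 1 1 - M 0 0) + 2 * c * M 0 1) (s := y - c * x) (t := x) (c := c)
          (by omega) hA hy1 hx (by linarith) h0.2 (by linarith [h1.2]) hm
        linarith

/-- A lower bound for the off-diagonal entries of all rotations of a word bounds the
Markov–Davenport form on all non-zero integer vectors. -/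
theorem le_abs_markovDavenport {m : ℤ} (hm : 0 ≤ m) (l : List ℕ) (hl : l ≠ [])
    (hpos : ∀ c ∈ l, 0 < c)
    (hrot : ∀ k, m ≤ wordMat (l.rotate k) 1 0 ∧ m ≤ wordMat (l.rotate k) 0 1)
    (v : Fin 2 → ℤ) (hv : v ≠ 0) :
    m ≤ |markovDavenport (wordMat l) v| := by
  have hvec : v = ![v 0, v 1] := by ext j; fin_cases j <;> rfl
  have hne : v 0 ≠ 0 ∨ v 1 ≠ 0 := by
    by_contra h
    push Not at h
    apply hv
    rw [hvec, h.1, h.2]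
    ext j; fin_cases j <;> rfl
  have key : ∀ x y : ℤ, 0 ≤ x → (x ≠ 0 ∨ y ≠ 0) →
      m ≤ |markovDavenport (wordMat l) ![x, y]| := by
    intro x y hx hxy
    rcases le_total 0 y with hy | hy
    · exact le_abs_markovDavenport_of_nonneg hm (x + y).toNat l hl hpos hrot x y hx hy
        (by omega) (by omega)
    -- A quarter turn carries the fourth quadrant to the first and f to minus the form of the
    -- transpose, that is, of the reversed word.
    · have h := le_abs_markovDavenport_of_nonneg hm (x + -y).toNat l.reverse (by simpa using hl)
        (by simpa using hpos) ?_ (-y) x (by omega) hx (by omega) (by omega)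
      · rw [wordMat_reverse, markovDavenport_apply] at h
        rw [markovDavenport_apply, ← abs_neg]
        simp only [Matrix.transpose_apply] at h
        convert h using 2
        ring
      · intro k
        rw [List.rotate_reverse, wordMat_reverse]
        exact ⟨(hrot _).2, (hrot _).1⟩
  rw [hvec]
  rcases le_total 0 (v 0) with h | h
  · exact key _ _ h hne
  · have := key (-v 0) (-v 1) (by omega) (by omega)
    rw [markovDavenport_apply] at this ⊢
    convert this using 2
    ring

/-! ### Exchange of adjacent letters. -/

/-- Exchanging two adjacent letters between comparable words changes the lower left entry of the
product monotonically. -/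
theorem wordMat_exchange_le {a b : ℕ} (hab : a ≤ b) {u v : List ℕ} (h : u <+: v ∨ v <+: u) :
    wordMat (u.reverse ++ a :: b :: v) 1 0 ≤ wordMat (u.reverse ++ b :: a :: v) 1 0 := by
  -- The commutator of two symmetric 2 × 2 matrices is a multiple of the quarter turn, here by ± a b
  -- (b - a).
  have hdiff : wordMat (u.reverse ++ b :: a :: v) 1 0 - wordMat (u.reverse ++ a :: b :: v) 1 0
      = (a * b * (b - a) : ℤ)
        * (wordMat u 1 1 * wordMat v 0 0 - wordMat u 0 1 * wordMat v 1 0) := by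
    simp only [wordMat_append, wordMat_cons, wordMat_reverse, sqMat, Matrix.mul_apply,
      Fin.sum_univ_two, Matrix.transpose_apply]
    simp
    ring
  -- Since determinants are 1, cancelling the common prefix leaves a diagonal entry of the product
  -- over the remaining word.
  have hpos : 0 ≤ wordMat u 1 1 * wordMat v 0 0 - wordMat u 0 1 * wordMat v 1 0 := by
    rcases h with ⟨z, rfl⟩ | ⟨z, rfl⟩
    · have hd := wordMat_det u
      rw [Matrix.det_fin_two] at hd
      have hz := wordMat_nonneg z 0 0
      have : wordMat u 1 1 * wordMat (u ++ z) 0 0 - wordMat u 0 1 * wordMat (u ++ z) 1 0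
          = wordMat z 0 0 := by
        simp only [wordMat_append, Matrix.mul_apply, Fin.sum_univ_two]
        linear_combination wordMat z 0 0 * hd
      omega
    · have hd := wordMat_det v
      rw [Matrix.det_fin_two] at hd
      have hz := wordMat_nonneg z 1 1
      have : wordMat (v ++ z) 1 1 * wordMat v 0 0 - wordMat (v ++ z) 0 1 * wordMat v 1 0
          = wordMat z 1 1 := by
        simp only [wordMat_append, Matrix.mul_apply, Fin.sum_univ_two]
        linear_combination wordMat z 1 1 * hd
      omega
  have hab' : (0 : ℤ) ≤ b - a := by
    have : (a : ℤ) ≤ b := by exact_mod_cast hab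
    omega
  have : (0 : ℤ) ≤ a * b * (b - a)
      * (wordMat u 1 1 * wordMat v 0 0 - wordMat u 0 1 * wordMat v 1 0) := by positivity
  omega

/-! ### Mechanical words -/

/-- The letter at the place `i` of the mechanical word of slope `p / q` and intercept `ρ / q`. -/
def mechLetter (p q ρ i : ℤ) : Fin 2 :=
  if (p * (i + 1) + ρ) / q = (p * i + ρ) / q then 0 else 1

/-- One period of the mechanical word of slope `p / q` and intercept `ρ / q`. -/
def mechWord (p : ℤ) (q : ℕ) (ρ : ℤ) : List (Fin 2) :=
  (List.range q).map fun i : ℕ => mechLetter p q ρ i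

theorem mechLetter_add (p q ρ i k : ℤ) :
    mechLetter p q ρ (i + k) = mechLetter p q (ρ + p * k) i := by
  simp only [mechLetter]
  rw [show p * (i + k + 1) + ρ = p * (i + 1) + (ρ + p * k) by ring,
    show p * (i + k) + ρ = p * i + (ρ + p * k) by ring]

theorem mechLetter_add_mul {q : ℤ} (hq : 0 < q) (p ρ i n : ℤ) :
    mechLetter p q (ρ + n * q) i = mechLetter p q ρ i := by
  simp only [mechLetter, ← add_assoc, Int.add_mul_ediv_right _ _ hq.ne']
  simp

theorem mechLetter_intercept_congr {q : ℤ} (hq : 0 < q) (p i : ℤ) {ρ ρ' : ℤ} (h : ρ ≡ ρ' [ZMOD q]) :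
    mechLetter p q ρ i = mechLetter p q ρ' i := by
  obtain ⟨n, hn⟩ := h.dvd
  rw [show ρ' = ρ + n * q by linear_combination hn, mechLetter_add_mul hq]

theorem mechLetter_congr {q : ℤ} (hq : 0 < q) (p ρ : ℤ) {i j : ℤ} (h : i ≡ j [ZMOD q]) :
    mechLetter p q ρ i = mechLetter p q ρ j := by
  have h1 := mechLetter_add p q ρ 0 i
  have h2 := mechLetter_add p q ρ 0 j
  rw [zero_add] at h1 h2
  rw [h1, h2]
  exact mechLetter_intercept_congr hq p 0 ((h.mul_left p).add_left ρ)

theorem neg_one_sub_ediv {q : ℤ} (hq : 0 < q) (m : ℤ) : (-1 - m) / q = -1 - m / q := by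
  have e := Int.mul_ediv_add_emod m q
  have r0 := Int.emod_nonneg m hq.ne'
  have r1 := Int.emod_lt_of_pos m hq
  rw [show -1 - m = (q - 1 - m % q) + (-1 - m / q) * q by linear_combination e,
    Int.add_mul_ediv_right _ _ hq.ne', Int.ediv_eq_zero_of_lt (by omega) (by omega), zero_add]

/-- The half turn of the staircase of floors maps place i to -1 - i and intercept ρ to -1 - ρ. -/
theorem mechLetter_neg {q : ℤ} (hq : 0 < q) (p ρ i : ℤ) :
    mechLetter p q ρ (-1 - i) = mechLetter p q (-1 - ρ) i := by
  simp only [mechLetter]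
  rw [show p * (-1 - i + 1) + ρ = -1 - (p * i + (-1 - ρ)) by ring,
    show p * (-1 - i) + ρ = -1 - (p * (i + 1) + (-1 - ρ)) by ring,
    neg_one_sub_ediv hq, neg_one_sub_ediv hq]
  congr 1
  apply propext
  constructor <;> intro h <;> omega

theorem mechWord_length (p : ℤ) (q : ℕ) (ρ : ℤ) : (mechWord p q ρ).length = q := by
  simp [mechWord]

/-- Advancing k places adds p k to the intercept, and only its residue modulo q matters. -/
theorem mechWord_rotate {p : ℤ} {q : ℕ} (hq : 0 < q) (k : ℕ) :
    (mechWord p q 0).rotate k = mechWord p q (p * k % q) := by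
  have hq' : (0 : ℤ) < q := by exact_mod_cast hq
  apply List.ext_getElem
  · simp [mechWord]
  · intro i h1 h2
    rw [List.getElem_rotate]
    simp only [mechWord, List.getElem_map, List.getElem_range, List.length_map, List.length_range]
    push_cast
    rw [mechLetter_congr hq' p 0 (Int.mod_modEq _ _), mechLetter_add]
    exact mechLetter_intercept_congr hq' p _ (by simpa using (Int.mod_modEq _ _).symm)

theorem mechWord_reverse {p : ℤ} {q : ℕ} (hq : 0 < q) (ρ : ℤ) :
    (mechWord p q ρ).reverse = mechWord p q (q - 1 - ρ) := by
  have hq' : (0 : ℤ) < q := by exact_mod_cast hq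
  apply List.ext_getElem
  · simp [mechWord]
  · intro i h1 h2
    rw [List.getElem_reverse]
    simp only [mechWord, List.getElem_map, List.getElem_range, List.length_map, List.length_range]
    have hi : i < q := by simpa [mechWord] using h2
    rw [show ((q - 1 - i : ℕ) : ℤ) = -1 - i + q by omega,
      mechLetter_congr hq' p ρ (by simp : (-1 - i + q : ℤ) ≡ -1 - i [ZMOD q]),
      mechLetter_neg hq']
    exact mechLetter_intercept_congr hq' p _
      ((Int.modEq_iff_dvd).mpr ⟨1, by ring⟩)

/-- Lowering the intercept from 0 to -1 changes a floor only where its numerator is a multiple of q.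
-/
theorem mechLetter_neg_one_eq {p q i : ℤ} (hq : 0 < q) (h : ¬ q ∣ p * i) (h' : ¬ q ∣ p * (i + 1)) :
    mechLetter p q (-1) i = mechLetter p q 0 i := by
  have key : ∀ m : ℤ, ¬ q ∣ m → (m + -1) / q = (m + 0) / q := by
    intro m hm
    have e := Int.mul_ediv_add_emod m q
    have r0 := Int.emod_nonneg m hq.ne'
    have r1 := Int.emod_lt_of_pos m hq
    have r2 : m % q ≠ 0 := fun h => hm (Int.dvd_of_emod_eq_zero h)
    rw [show m + -1 = (m % q - 1) + (m / q) * q by linear_combination -e,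
      Int.add_mul_ediv_right _ _ hq.ne', Int.ediv_eq_zero_of_lt (by omega) (by omega), zero_add,
      add_zero]
  simp only [mechLetter]
  rw [key _ h, key _ h']

/-- Mechanical words with successive intercepts differ by an exchange of two adjacent letters,
and the words on both sides of the two letters are prefixes of a common word. -/
theorem mechWord_succ {p : ℤ} {q : ℕ} (hp : 0 ≤ p) (hpq : p ≤ q) (hc : IsCoprime p (q : ℤ))
    {ρ : ℤ} (hρ : 0 ≤ ρ) (hρq : ρ + 1 < q) :
    ∃ u v : List (Fin 2), (u <+: v ∨ v <+: u) ∧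
      mechWord p q ρ = u.reverse ++ 0 :: 1 :: v ∧
      mechWord p q (ρ + 1) = u.reverse ++ 1 :: 0 :: v := by
  have hq : (0 : ℤ) < q := by omega
  have hp0 : p ≠ 0 := by
    rintro rfl
    rw [isCoprime_zero_left, Int.isUnit_iff] at hc
    omega
  have hpq' : p ≠ q := by
    rintro rfl
    rw [isCoprime_self, Int.isUnit_iff] at hc
    omega
  obtain ⟨s, t, hst⟩ := id hc
  -- As s inverts p modulo q, this is the place of the period where q divides p k + ρ + 1, the only
  -- one where the floors for ρ and ρ + 1 differ. It affects the letters at k - 1 and k; recentred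
  -- at k, the intercepts become -1 and 0.
  set k : ℤ := (-(ρ + 1) * s) % q with hk
  have k0 : 0 ≤ k := Int.emod_nonneg _ hq.ne'
  have k1 : k < q := Int.emod_lt_of_pos _ hq
  obtain ⟨N, hN⟩ : (q : ℤ) ∣ p * k + ρ + 1 := by
    have e := Int.mul_ediv_add_emod (-(ρ + 1) * s) q
    rw [← hk] at e
    refine ⟨(ρ + 1) * t - p * (-(ρ + 1) * s / q), ?_⟩
    linear_combination (p) * e - (ρ + 1) * hst
  have hk0 : k ≠ 0 := by
    intro h0
    rw [h0, mul_zero, zero_add] at hN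
    have : (q : ℤ) ∣ ρ + 1 := ⟨N, hN⟩
    have := Int.le_of_dvd (by omega) this
    omega
  have hdvd : ∀ i : ℤ, 0 < i → i < q → ¬ (q : ℤ) ∣ p * i := by
    intro i h0 h1 hd
    have := Int.le_of_dvd h0 (hc.symm.dvd_of_dvd_mul_left hd)
    omega
  have c1 : ∀ j : ℤ, mechLetter p q ρ (j + k) = mechLetter p q (-1) j := by
    intro j
    rw [mechLetter_add, show ρ + p * k = -1 + N * q by linear_combination hN,
      mechLetter_add_mul hq]
  have c2 : ∀ j : ℤ, mechLetter p q (ρ + 1) (j + k) = mechLetter p q 0 j := by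
    intro j
    rw [mechLetter_add, show ρ + 1 + p * k = 0 + N * q by linear_combination hN,
      mechLetter_add_mul hq]
  have l0 : mechLetter p q 0 0 = 0 := by
    simp only [mechLetter]
    rw [if_pos]
    rw [Int.ediv_eq_zero_of_lt (by omega) (by omega)]
    simp
  have l1 : mechLetter p q (-1) 0 = 1 := by
    simp only [mechLetter]
    rw [if_neg]
    rw [Int.ediv_eq_zero_of_lt (by omega) (by omega),
      show p * 0 + -1 = (q - 1 : ℤ) + (-1) * q by ring,
      Int.add_mul_ediv_right _ _ hq.ne', Int.ediv_eq_zero_of_lt (by omega) (by omega)]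
    simp
  have l2 : mechLetter p q (-1) (-1) = 0 := by
    have := mechLetter_neg hq p (-1) 0
    simpa [l0] using this
  have l3 : mechLetter p q 0 (-1) = 1 := by
    have := mechLetter_neg hq p 0 0
    simpa [l1] using this
  obtain ⟨m, hm⟩ : ∃ m : ℕ, k = m + 1 := ⟨(k - 1).toNat, by omega⟩
  obtain ⟨n, hn⟩ : ∃ n : ℕ, q = m + (2 + n) := ⟨(q - m - 2 : ℤ).toNat, by omega⟩
  -- Read outward from the exchanged pair, both sides are initial segments of `g`, by the half turn;
  -- so one is a prefix of the other.
  let g : ℕ → Fin 2 := fun j => mechLetter p q 0 (j + 1)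
  have decomp : ∀ ρ' : ℤ,
      (∀ j : ℕ, j < m → mechLetter p q ρ' (-2 - j + k) = g j) →
      (∀ j : ℕ, j < n → mechLetter p q ρ' (j + 1 + k) = g j) →
      mechWord p q ρ' = ((List.range m).map g).reverse ++
        mechLetter p q ρ' (-1 + k) :: mechLetter p q ρ' (0 + k) :: (List.range n).map g := by
    intro ρ' h1 h2
    have e : List.range q
        = List.range m ++ (m :: (m + 1) :: (List.range n).map fun j => m + (2 + j)) := by
      rw [hn, List.range_add, List.range_add]
      simp [List.range_succ, add_assoc]
    rw [mechWord, e, List.map_append, List.map_cons, List.map_cons]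
    congr 1
    · apply List.ext_getElem
      · simp
      · intro i hi1 hi2
        have hi : i < m := by simpa using hi1
        rw [List.getElem_reverse]
        simp only [List.getElem_map, List.getElem_range, List.length_map, List.length_range]
        rw [← h1 _ (by omega)]
        congr 1
        omega
    · congr 1
      · congr 1; omega
      · congr 1
        · congr 1; push_cast; omega
        · rw [List.map_map]
          apply List.map_congr_left
          intro j hj
          rw [← h2 j (List.mem_range.mp hj)]
          simp only [Function.comp]
          congr 1
          push_cast
          omega
  have hneg : ∀ j : ℕ, j < m ∨ j < n →
      mechLetter p q (-1) (j + 1) = mechLetter p q 0 (j + 1) := fun j hj =>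
    mechLetter_neg_one_eq hq (hdvd _ (by omega) (by omega)) (hdvd _ (by omega) (by omega))
  refine ⟨(List.range m).map g, (List.range n).map g, ?_, ?_, ?_⟩
  · rcases le_total m n with h | h
    · left
      obtain ⟨d, rfl⟩ := Nat.exists_eq_add_of_le h
      rw [List.range_add, List.map_append]
      exact List.prefix_append _ _
    · right
      obtain ⟨d, rfl⟩ := Nat.exists_eq_add_of_le h
      rw [List.range_add, List.map_append]
      exact List.prefix_append _ _
  · rw [decomp ρ, c1, c1, l1, l2]
    · intro j _
      rw [c1, show (-2 - j : ℤ) = -1 - (j + 1) by ring, mechLetter_neg hq]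
      simp [g]
    · intro j hj
      rw [c1, hneg j (Or.inr hj)]
  · rw [decomp (ρ + 1), c2, c2, l0, l3]
    · intro j hj
      rw [c2, show (-2 - j : ℤ) = -1 - (j + 1) by ring, mechLetter_neg hq, sub_zero,
        hneg j (Or.inl hj)]
    · intro j _
      rw [c2]

/-- The off-diagonal entries of the products over the rotations of a mechanical word of
intercept zero are minimal for the word itself. -/
theorem wordMat_mechWord_rotate_le {a b : ℕ} (hab : a ≤ b) {p : ℤ} {q : ℕ} (hq : 0 < q)
    (hp : 0 ≤ p) (hpq : p ≤ q) (hc : IsCoprime p (q : ℤ)) (k : ℕ) :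
    wordMat ((mechWord p q 0).map ![a, b]) 1 0
        ≤ wordMat (((mechWord p q 0).map ![a, b]).rotate k) 1 0 ∧
      wordMat ((mechWord p q 0).map ![a, b]) 1 0
        ≤ wordMat (((mechWord p q 0).map ![a, b]).rotate k) 0 1 := by
  -- The intercept climbs from 0 to n in unit steps, each an exchange that does not decrease the
  -- entry.
  have mono : ∀ n : ℕ, n < q → wordMat ((mechWord p q 0).map ![a, b]) 1 0
      ≤ wordMat ((mechWord p q n).map ![a, b]) 1 0 := by
    intro n
    induction n with
    | zero => intro _; simp
    | succ n ih =>
      intro hn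
      refine (ih (by omega)).trans ?_
      obtain ⟨u, v, huv, h1, h2⟩ := mechWord_succ (ρ := n) hp hpq hc (by omega) (by omega)
      rw [Nat.cast_succ, h1, h2]
      simpa using wordMat_exchange_le hab
        (huv.imp (fun h => h.map ![a, b]) (fun h => h.map ![a, b]))
  have mono' : ∀ r : ℤ, 0 ≤ r → r < q → wordMat ((mechWord p q 0).map ![a, b]) 1 0
      ≤ wordMat ((mechWord p q r).map ![a, b]) 1 0 := by
    intro r h0 h1
    obtain ⟨n, rfl⟩ := Int.eq_ofNat_of_zero_le h0
    exact mono n (by exact_mod_cast h1)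
  have hq' : (0 : ℤ) < q := by exact_mod_cast hq
  have r0 := Int.emod_nonneg (p * k) hq'.ne'
  have r1 := Int.emod_lt_of_pos (p * k) hq'
  rw [← List.map_rotate, mechWord_rotate hq]
  refine ⟨mono' _ r0 r1, ?_⟩
  -- The upper right entry is the lower left entry of the reversed word, whose intercept is again in
  -- range.
  have h := mono' (q - 1 - p * k % q) (by omega) (by omega)
  rw [← mechWord_reverse hq, List.map_reverse, wordMat_reverse, Matrix.transpose_apply] at h
  exact h

/-! ### Uniqueness of the Farey map -/

theorem rat_num_den_of_coprime {p q : ℤ} (hq : 0 < q) (h : IsCoprime p q) :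
    ((p : ℚ) / q).num = p ∧ (((p : ℚ) / q).den : ℤ) = q := by
  have hg := Int.isCoprime_iff_gcd_eq_one.mp h
  exact ⟨Rat.num_div_eq_of_coprime hq hg, Rat.den_div_eq_of_coprime hq hg⟩

/-- Every rational number strictly between `0` and `1` is the mediant of a Farey edge. -/
theorem exists_fareyEdge_mediant {t : ℚ} (h0 : 0 < t) (h1 : t < 1) :
    ∃ r s : ℚ, FareyEdge r s ∧ mediant r s = t ∧ r.den < t.den ∧ s.den < t.den := by
  have hd : (0 : ℤ) < t.den := by exact_mod_cast t.den_pos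
  have hn : 0 < t.num := Rat.num_pos.mpr h0
  have hnd : t.num < t.den := Rat.num_lt_denom_iff.mpr h1
  have hc : IsCoprime t.num (t.den : ℤ) := Rat.isCoprime_num_den t
  obtain ⟨u, v, huv⟩ := hc
  set n := t.num
  set d : ℤ := (t.den : ℤ)
  -- The inverse of the numerator modulo d is the denominator of the left parent p/q; the right
  -- parent is (n - p)/(d - q).
  set q : ℤ := u % d with hq
  have q0 : 0 ≤ q := Int.emod_nonneg _ hd.ne'
  have q1 : q < d := Int.emod_lt_of_pos _ hd
  obtain ⟨p, hp⟩ : ∃ p : ℤ, n * q - p * d = 1 := by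
    have e := Int.mul_ediv_add_emod u d
    rw [← hq] at e
    exact ⟨-v - n * (u / d), by linear_combination n * e + huv⟩
  have hq0 : 0 < q := by
    rcases q0.eq_or_lt with h | h
    · rw [← h] at hp
      have : d ∣ 1 := ⟨-p, by linear_combination -hp⟩
      have := Int.le_of_dvd one_pos this
      omega
    · exact h
  have hp0 : 0 ≤ p := by
    by_contra h
    have : p * d ≤ -1 * d := by gcongr; omega
    have : 0 < n * q := by positivity
    omega
  obtain ⟨rn, rd⟩ := rat_num_den_of_coprime (p := p) (q := q) hq0
    ⟨-d, n, by linear_combination hp⟩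
  obtain ⟨sn, sd⟩ := rat_num_den_of_coprime (p := n - p) (q := d - q) (by omega)
    ⟨q, -p, by linear_combination hp⟩
  set r : ℚ := (p : ℚ) / q
  set s : ℚ := ((n - p : ℤ) : ℚ) / ((d - q : ℤ) : ℚ)
  have he : s.num * r.den - r.num * s.den = 1 := by
    rw [rn, rd, sn, sd]; linear_combination hp
  obtain ⟨mn, md⟩ := mediant_num_den he
  refine ⟨r, s, ⟨?_, ?_, he⟩, ?_, by omega, by omega⟩
  · rw [← Rat.num_nonneg, rn]; exact hp0
  · rw [← Rat.num_le_denom_iff, sn, sd]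
    have h2 : d * (n - p) = n * (d - q) + 1 := by linear_combination hp
    have h3 : n * (d - q) ≤ (d - 1) * (d - q) := by gcongr; omega
    have h4 : d * (n - p) ≤ d * (d - q) := by linarith
    exact le_of_mul_le_mul_left h4 hd
  · apply Rat.ext
    · rw [mn, rn, sn]; omega
    · rw [md]; omega

/-- Induction on the denominator, as both parents have smaller ones. This permits replacing the
chosen `fareyMap` by the explicit product over mechanical words. -/
theorem IsFareyMap.eq_of_mem_unitInterval {G : Type*} [Monoid G] {A B : G} {F F' : ℚ → G}
    (hF : IsFareyMap A B F) (hF' : IsFareyMap A B F') {t : ℚ} (h0 : 0 ≤ t) (h1 : t ≤ 1) :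
    F t = F' t := by
  induction hd : t.den using Nat.strong_induction_on generalizing t with
  | _ d ih =>
    rcases h0.eq_or_lt with rfl | h0
    · rw [hF.zero, hF'.zero]
    rcases h1.eq_or_lt with rfl | h1
    · rw [hF.one, hF'.one]
    obtain ⟨r, s, he, rfl, hr, hs⟩ := exists_fareyEdge_mediant h0 h1
    have hrs : r < s := by
      rw [Rat.lt_iff]
      linarith [he.2.2]
    rw [hF.map_mediant r s he, hF'.map_mediant r s he,
      ih r.den (hd ▸ hr) he.1 (hrs.le.trans he.2.1) rfl,
      ih s.den (hd ▸ hs) (he.1.trans hrs.le) he.2.1 rfl]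

/-- The lines of slope r and of the mediant have equal floors up to the denominator of r; beyond it
the floors follow the line of slope s, shifted by the numerator of r. -/
theorem mechWord_mediant {r s : ℚ} (h : s.num * r.den - r.num * s.den = 1) :
    mechWord (mediant r s).num (mediant r s).den 0
      = mechWord r.num r.den 0 ++ mechWord s.num s.den 0 := by
  obtain ⟨hn, hd⟩ := mediant_num_den h
  have hq : (0 : ℤ) < r.den := by exact_mod_cast r.den_pos
  have hq' : (0 : ℤ) < s.den := by exact_mod_cast s.den_pos
  simp only [mechWord, mechLetter, add_zero, hn, hd, List.range_add, List.map_append, List.map_map]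
  congr 1
  · apply List.map_congr_left
    intro i hi
    have hi' : (i : ℤ) < r.den := by exact_mod_cast List.mem_range.mp hi
    push_cast
    rw [ediv_mediant_left hq hq' h (by positivity) (by linarith),
      ediv_mediant_left hq hq' h (by positivity) (by linarith)]
  · apply List.map_congr_left
    intro j hj
    have hj' : (j : ℤ) < s.den := by exact_mod_cast List.mem_range.mp hj
    simp only [Function.comp]
    push_cast
    rw [add_assoc (r.den : ℤ), ediv_mediant_right hq hq' h (by positivity) (by linarith),
      ediv_mediant_right hq hq' h (by positivity) (by linarith)]
    simp

/-- The Farey map is the product over the mechanical words of intercept zero. -/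
theorem fareyMap_eq_prod {G : Type*} [Monoid G] (g : Fin 2 → G) {t : ℚ} (h0 : 0 ≤ t)
    (h1 : t ≤ 1) :
    fareyMap (g 0) (g 1) t = ((mechWord t.num t.den 0).map g).prod := by
  refine IsFareyMap.eq_of_mem_unitInterval (Classical.choose_spec (exists_isFareyMap (g 0) (g 1)))
    (F' := fun t : ℚ => ((mechWord t.num t.den 0).map g).prod) ⟨?_, ?_, ?_⟩ h0 h1
  · simp [mechWord, mechLetter]
  · simp [mechWord, mechLetter]
  · intro r s h
    simp only [mechWord_mediant h.2.2, List.map_append, List.prod_append]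

/-! ### The common basis -/

theorem compMat_det (c : ℤ) : (compMat c).det = -1 := by
  simp [compMat, Matrix.det_fin_two]

theorem compMat_mul_inv (c : ℤ) : compMat c * (compMat c)⁻¹ = 1 :=
  Matrix.mul_nonsing_inv _ (by simp [compMat_det])

theorem compMat_inv_mul (c : ℤ) : (compMat c)⁻¹ * compMat c = 1 :=
  Matrix.nonsing_inv_mul _ (by simp [compMat_det])

theorem sqMat_eq (c : ℕ) : sqMat c = compMat c * compMat c := by
  simp [sqMat, compMat]

/-- M_{1,a} commutes with its own square, so conjugation by it fixes M_1 while producing M_2 from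
M_{1,b}^2. -/
theorem gen_eq_conj (a b : ℕ) (i : Fin 2) :
    gen a b i = compMat a * sqMat (![a, b] i) * (compMat a)⁻¹ := by
  fin_cases i
  · change compMat a ^ 2 = compMat a * sqMat a * (compMat a)⁻¹
    rw [sqMat_eq, pow_two, Matrix.mul_assoc, Matrix.mul_assoc, compMat_mul_inv, Matrix.mul_one]
  · change (compMat a * compMat b * (compMat a)⁻¹) ^ 2 = compMat a * sqMat b * (compMat a)⁻¹
    rw [sqMat_eq, pow_two]
    simp only [Matrix.mul_assoc]
    rw [← Matrix.mul_assoc (compMat a)⁻¹ (compMat a), compMat_inv_mul, Matrix.one_mul]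

theorem prod_gen_eq_conj (a b : ℕ) (w : List (Fin 2)) :
    (w.map (gen a b)).prod = compMat a * wordMat (w.map ![a, b]) * (compMat a)⁻¹ := by
  induction w with
  | nil => simp [wordMat_nil, compMat_mul_inv]
  | cons i w ih =>
    rw [List.map_cons, List.prod_cons, ih, gen_eq_conj, List.map_cons, wordMat_cons]
    simp only [Matrix.mul_assoc]
    rw [← Matrix.mul_assoc (compMat a)⁻¹ (compMat a), compMat_inv_mul, Matrix.one_mul]

theorem exists_hasPLLS (a b : ℕ) (ha : 0 < a) (hb : 0 < b) :
    ∃ U : GL (Fin 2) ℤ, HasPLLS U (gen a b 0) [a, a] ∧ HasPLLS U (gen a b 1) [b, b] := by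
  let U : GL (Fin 2) ℤ := ⟨compMat a, (compMat a)⁻¹, compMat_mul_inv _, compMat_inv_mul _⟩
  have h : ∀ i, (U⁻¹ : GL (Fin 2) ℤ).val * gen a b i * U.val = sqMat (![a, b] i) := by
    intro i
    change (compMat a)⁻¹ * gen a b i * compMat a = _
    rw [gen_eq_conj]
    simp only [Matrix.mul_assoc]
    rw [compMat_inv_mul, Matrix.mul_one, ← Matrix.mul_assoc, compMat_inv_mul, Matrix.one_mul]
  refine ⟨U, ⟨by simpa using ha, ?_⟩, ⟨by simpa using hb, ?_⟩⟩
  · rw [h 0]; simp [sqMat_eq]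
  · rw [h 1]; simp [sqMat_eq]

/-- This links the upper right entry of F(t) to the lower left entry that the exchange argument
controls. -/
theorem conj_compMat_apply_zero_one (c : ℤ) (M : Matrix (Fin 2) (Fin 2) ℤ) :
    (compMat c * M * (compMat c)⁻¹) 0 1 = M 1 0 := by
  rw [compMat_inv]
  simp only [compMat, Matrix.mul_apply, Fin.sum_univ_two]
  simp

/-- The base change has determinant -1, which only flips the sign of the form. -/
theorem abs_markovDavenport_conj (c : ℤ) (M : Matrix (Fin 2) (Fin 2) ℤ) (v : Fin 2 → ℤ) :
    |markovDavenport (compMat c * M * (compMat c)⁻¹) v|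
      = |markovDavenport M ((compMat c)⁻¹ *ᵥ v)| := by
  have h := markovDavenport_mul_comm (compMat c) (M * (compMat c)⁻¹) ((compMat c)⁻¹ *ᵥ v)
  rw [Matrix.mulVec_mulVec, compMat_mul_inv, Matrix.one_mulVec, Matrix.mul_assoc M,
    compMat_inv_mul, Matrix.mul_one, ← Matrix.mul_assoc, compMat_det] at h
  rw [h, neg_one_mul, abs_neg]

/-! ### Markov numbers of the Farey set -/

theorem algebraicMarkov_eq (M : Matrix (Fin 2) (Fin 2) ℤ) : algebraicMarkov M = |M 0 1| := by
  rw [algebraicMarkov, markovDavenport_apply]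
  simp

theorem fareyMap_gen_eq_conj (a b : ℕ) {t : ℚ} (h0 : 0 ≤ t) (h1 : t ≤ 1) :
    fareyMap (gen a b 0) (gen a b 1) t
      = compMat a * wordMat ((mechWord t.num t.den 0).map ![a, b]) * (compMat a)⁻¹ := by
  rw [fareyMap_eq_prod (gen a b) h0 h1, prod_gen_eq_conj]

theorem fareyMap_gen_apply_nonneg (a b : ℕ) {t : ℚ} (h0 : 0 ≤ t) (h1 : t ≤ 1) :
    0 ≤ fareyMap (gen a b 0) (gen a b 1) t 0 1 := by
  rw [fareyMap_gen_eq_conj a b h0 h1, conj_compMat_apply_zero_one]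
  exact wordMat_nonneg _ _ _

/-- The upper right entry is a lower bound for the Markov–Davenport form. -/
theorem le_abs_markovDavenport_fareyMap {a b : ℕ} (ha : 0 < a) (hab : a < b) {t : ℚ} (h0 : 0 ≤ t)
    (h1 : t ≤ 1) (v : Fin 2 → ℤ) (hv : v ≠ 0) :
    fareyMap (gen a b 0) (gen a b 1) t 0 1
      ≤ |markovDavenport (fareyMap (gen a b 0) (gen a b 1) t) v| := by
  rw [fareyMap_gen_eq_conj a b h0 h1, conj_compMat_apply_zero_one, abs_markovDavenport_conj]
  refine le_abs_markovDavenport (wordMat_nonneg _ _ _) _ ?_ ?_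
    (wordMat_mechWord_rotate_le hab.le t.den_pos (Rat.num_nonneg.mpr h0)
      (Rat.num_le_denom_iff.mpr h1) (Rat.isCoprime_num_den t)) _ ?_
  · intro h
    have := congrArg List.length h
    simp [mechWord_length] at this
  · intro c hc
    obtain ⟨i, -, rfl⟩ := List.mem_map.mp hc
    fin_cases i
    · exact ha
    · exact ha.trans hab
  · intro h
    apply hv
    have := congrArg (compMat a *ᵥ ·) h
    simpa only [Matrix.mulVec_mulVec, compMat_mul_inv, Matrix.one_mulVec,
      Matrix.mulVec_zero] using this

theorem geometricMarkov_fareyMap {a b : ℕ} (ha : 0 < a) (hab : a < b) {t : ℚ} (h0 : 0 ≤ t)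
    (h1 : t ≤ 1) :
    geometricMarkov (fareyMap (gen a b 0) (gen a b 1) t)
      = (fareyMap (gen a b 0) (gen a b 1) t 0 1 : ℤ) := by
  have hne : (![0, 1] : Fin 2 → ℤ) ≠ 0 := fun h => by simpa using congrFun h 1
  have : Nonempty {p : Fin 2 → ℤ // p ≠ 0} := ⟨⟨_, hne⟩⟩
  apply le_antisymm
  -- The vector (0, 1) attains the bound, its value being the algebraic Markov number.
  · refine (ciInf_le ⟨0, ?_⟩ ⟨![0, 1], hne⟩).trans ?_
    · rintro _ ⟨p, rfl⟩
      exact abs_nonneg _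
    · have h := algebraicMarkov_eq (fareyMap (gen a b 0) (gen a b 1) t)
      rw [abs_of_nonneg (fareyMap_gen_apply_nonneg a b h0 h1), algebraicMarkov] at h
      rw [← Int.cast_abs, h]
  · refine le_ciInf fun p => ?_
    rw [← Int.cast_abs]
    exact_mod_cast le_abs_markovDavenport_fareyMap ha hab h0 h1 p.1 p.2

theorem mainTheorem4 (a b : ℕ) (ha : 0 < a) (hab : a < b) :
    -- the two generators are reduced in a common basis, with PLLS-sequences `(a, a)` and `(b, b)`
    (∃ U : GL (Fin 2) ℤ, HasPLLS U (gen a b 0) [a, a] ∧ HasPLLS U (gen a b 1) [b, b]) ∧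
    -- each building element acts on the last two terms of the perfect matching sequence as `M_i`
    (∀ (i : Fin 2) (W : WugSnake), 2 ≤ W.size →
      (![(((W.attach (block a b i)).mu ((W.attach (block a b i)).size - 1) : ℕ) : ℤ),
          (((W.attach (block a b i)).mu (W.attach (block a b i)).size : ℕ) : ℤ)] : Fin 2 → ℤ)
        = gen a b i *ᵥ ![((W.mu (W.size - 1) : ℕ) : ℤ), ((W.mu W.size : ℕ) : ℤ)]) ∧
    -- there are heads of length three for the starting sequence `(0, 0, 1)`
    (∃ H : WugSnake, H.size = 3 ∧ H.IsHead [0, 0, 1]) ∧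
    -- perfect matchings, algebraic and geometric Markov numbers of the Farey set
    (∀ t : ℚ, 0 ≤ t → t ≤ 1 →
      (∃ w : List (Fin 2), (w.map (gen a b)).prod = fareyMap (gen a b 0) (gen a b 1) t) ∧
      ∀ w : List (Fin 2), (w.map (gen a b)).prod = fareyMap (gen a b 0) (gen a b 1) t →
        ∀ H : WugSnake, H.IsHead [0, 0, 1] →
          ((((H.attach (body a b w)).mu ((H.attach (body a b w)).size - 1) : ℕ) : ℤ)
            = fareyMap (gen a b 0) (gen a b 1) t 0 1) ∧
          ((((H.attach (body a b w)).mu ((H.attach (body a b w)).size - 1) : ℕ) : ℤ)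
            = algebraicMarkov (fareyMap (gen a b 0) (gen a b 1) t)) ∧
          ((((H.attach (body a b w)).mu ((H.attach (body a b w)).size - 1) : ℕ) : ℝ)
            = geometricMarkov (fareyMap (gen a b 0) (gen a b 1) t))) := by
  refine ⟨exists_hasPLLS a b ha (ha.trans hab),
    fun i W hW => WugSnake.attach_block_lastTwo a b hab i W hW, WugSnake.exists_isHead,
    fun t h0 h1 => ⟨⟨mechWord t.num t.den 0, (fareyMap_eq_prod (gen a b) h0 h1).symm⟩,
      fun w hw H hH => ?_⟩⟩
  -- Omitting the last pair of vertices selects the first coordinate of F(t) applied to (0, 1). Only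
  -- the product of `w` and the last two terms of the head enter, hence the independence of both
  -- choices.
  have hmu : (((H.attach (body a b w)).mu ((H.attach (body a b w)).size - 1) : ℕ) : ℤ)
      = fareyMap (gen a b 0) (gen a b 1) t 0 1 := by
    have h := congrFun (WugSnake.attach_body_lastTwo a b hab w H hH.lastTwo.1) 0
    rw [hH.lastTwo.2, hw] at h
    simpa [WugSnake.lastTwo, Matrix.mulVec, dotProduct, Fin.sum_univ_two] using h
  refine ⟨hmu, ?_, ?_⟩
  · rw [algebraicMarkov_eq, abs_of_nonneg (fareyMap_gen_apply_nonneg a b h0 h1), hmu]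
  · rw [geometricMarkov_fareyMap ha hab h0 h1, ← hmu, Int.cast_natCast]
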